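/- For every real $d$ with $0<d<1$ there exist $\varepsilon>0$ and $C>0$ such that the following holds. Let $G$ be a finite graph and let $U,V,W$ be pairwise disjoint sets of vertices of $G$ with $|U|=|V|=|W|=n$ such that the pairs $(V,U)$ and $(V,W)$ are $(\varepsilon,d)$-super-regular in $G$. Let $p\in[0,1]$ satisfy $p\ge C\log n/n$, and let $G(U,W,p)$ be the random bipartite graph in which each pair $uw$ with $u\in U$, $w\in W$ is an edge with probability $p$, independently of all other pairs. Then asymptotically almost surely the subgraph of $G\cup G(U,W,p)$ induced on $U\cup V\cup W$ contains a triangle-factor, that is, $n$ pairwise vertex-disjoint triangles. Here a pair $(A,B)$ of disjoint vertex sets is $(\varepsilon,d)$-super-regular in $G$ if $e(S,T)\ge d|S||T|$, i.e. the density $e(S,T)/(|S||T|)$ is at least $d$, for all $S\subseteq A$ and $T\subseteq B$ with $|S|\ge\varepsilon|A|$ and $|T|\ge\varepsilon|B|$, every $a\in A$ has at least $d|B|$ neighbours in $B$, and every $b\in B$ has at least $d|A|$ neighbours in $A$. "Asymptotically almost surely" means that the probability tends to $1$ as $n\to\infty$, uniformly over all such $G,U,V,W,p$: for every $\eta>0$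 there is $n_0$, depending only on $d$ and $\eta$, such that for all $n\ge n_0$ and all $G,U,V,W,p$ as above the probability is at least $1-\eta$. -/

import Mathlib

open MeasureTheory ProbabilityTheory unitInterval
open scoped Finset

/-- The law of the binomial random bipartite graph `G(U, W, p)`, as a measure on the graphs with
vertex set `X`: every pair `uw` with `u ∈ U` and `w ∈ W` is an edge with probability `p`,
independently of all other pairs, and there are no other edges. -/
noncomputable def bipartiteRandom {X : Type*} (U W : Finset X) (p : I) :
    Measure (SimpleGraph X) :=
  setBer((SimpleGraph.between (U : Set X) (W : Set X) ⊤).edgeSet, p).map SimpleGraph.fromEdgeSet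

open Classical in
/-- The pair `(A, B)` is `(ε, d)`-super-regular in `G`: all large subsets span density at least `d`,
and every vertex has at least a proportion `d` of the opposite class among its neighbours. -/
def IsSuperRegular {X : Type*} (G : SimpleGraph X) (ε d : ℝ) (A B : Finset X) : Prop :=
  (∀ S ⊆ A, ∀ T ⊆ B, ε * (#A : ℝ) ≤ (#S : ℝ) → ε * (#B : ℝ) ≤ (#T : ℝ) →
    d ≤ (G.edgeDensity S T : ℝ)) ∧
  (∀ a ∈ A, d * (#B : ℝ) ≤ (#{b ∈ B | G.Adj a b} : ℝ)) ∧
  (∀ b ∈ B, d * (#A : ℝ) ≤ (#{a ∈ A | G.Adj a b} : ℝ))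

/-- `G[S]` contains a triangle-factor: `⌊|S| / 3⌋` pairwise vertex-disjoint triangles. -/
def HasTriangleFactorOn {X : Type*} (G : SimpleGraph X) (S : Finset X) : Prop :=
  ∃ T : Finset (Finset X), (∀ t ∈ T, t ⊆ S ∧ G.IsNClique 3 t) ∧
    (T : Set (Finset X)).PairwiseDisjoint id ∧ #T = #S / 3

/-! Fix, without using randomness, a perfect matching `f` of `V` into `U` in `G`. Join `v` to `w`
when `vw` is in `G` and `f v w` is in the random graph. As `f` is injective, distinct `vw` use
distinct random pairs, so this is a `p`-random subgraph of `G[V, W]`; a perfect matching `g` in it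
gives the triangles `v, f v, g v`. By Hall, failure means an edgeless pair `S, T` with `#S + #T = n
+ 1`. With `m = min #S #T`, super-regularity puts at least `(d/2) n m` edges of `G` between them
(`IsSuperRegular.le_card_interedges`), so the pair is edgeless with probability at most `n ^ (-4m)`.
A union bound over at most `n ^ (2m)` pairs for each of `n` sizes gives `1 / n`. -/

/-- Hall's theorem in its bipartite-hole form: if no two subsets `S ⊆ A` and `T ⊆ B` with
`#S + #T = n + 1` are completely unrelated, then `A` can be matched into `B`. -/
lemma exists_matching_of_no_bipartite_hole {α β : Type*} [Nonempty β] (r : α → β → Prop) {A : Finset α}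
    {B : Finset β} {n : ℕ} (hA : #A = n) (hB : #B = n)
    (h : ∀ S ⊆ A, ∀ T ⊆ B, #S + #T = n + 1 → ∃ s ∈ S, ∃ t ∈ T, r s t) :
    ∃ f : α → β, Set.InjOn f A ∧ ∀ a ∈ A, f a ∈ B ∧ r a (f a) := by
  classical
  obtain ⟨b₀⟩ := ‹Nonempty β›
  obtain ⟨f, hf, hft⟩ := (Finset.all_card_le_biUnion_card_iff_exists_injective
    (fun a : A ↦ {b ∈ B | r a b})).1 (by
      intro S
      by_contra! hlt
      set N := S.biUnion fun a : A ↦ {b ∈ B | r a b} with hN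
      have hNB : N ⊆ B := Finset.biUnion_subset.2 fun a _ ↦ Finset.filter_subset _ _
      have hSn : #S ≤ n := by simpa [hA] using S.card_le_univ
      have hc : #(B \ N) = n - #N := by rw [Finset.card_sdiff_of_subset hNB, hB]
      -- A Hall violator has `#N < #S`, so at least `n + 1 - #S` vertices of `B` lie outside `N`.
      obtain ⟨T, hT, hTc⟩ := Finset.exists_subset_card_eq (s := B \ N) (n := n + 1 - #S) (by omega)
      obtain ⟨s, hs, t, ht, hst⟩ := h (S.map (Function.Embedding.subtype _))
        (fun x hx ↦ by simp at hx; exact hx.1) T (hT.trans Finset.sdiff_subset)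
        (by rw [Finset.card_map]; omega)
      have ht' := Finset.mem_sdiff.1 (hT ht)
      simp only [Finset.mem_map, Function.Embedding.subtype_apply] at hs
      obtain ⟨a, ha, rfl⟩ := hs
      exact ht'.2 (Finset.mem_biUnion.2 ⟨a, ha, by simp [ht'.1, hst]⟩))
  refine ⟨fun a ↦ if ha : a ∈ A then f ⟨a, ha⟩ else b₀, fun a ha b hb hab ↦ ?_, fun a ha ↦ ?_⟩
  · simp only [Finset.mem_coe] at ha hb
    simpa [ha, hb, hf.eq_iff] using hab
  · simpa [ha] using hft ⟨a, ha⟩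

/-! ### Edge counts in super-regular pairs -/

open Classical in
/-- If at least `x` elements of `B` satisfy `q`, then so do at least `x - #(B \ T)` elements of
`T ⊆ B`. -/
lemma card_filter_sub_le {β : Type*} (q : β → Prop) {B T : Finset β} (hT : T ⊆ B) {x : ℝ}
    (hx : x ≤ (#{b ∈ B | q b} : ℝ)) : x - ((#B : ℝ) - #T) ≤ (#{b ∈ T | q b} : ℝ) := by
  have h1 : #{b ∈ B | q b} ≤ #{b ∈ T | q b} + #(B \ T) := by
    refine (Finset.card_le_card fun b hb ↦ ?_).trans (Finset.card_union_le _ _)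
    simp only [Finset.mem_filter, Finset.mem_union, Finset.mem_sdiff] at hb ⊢
    tauto
  have h2 := Finset.card_sdiff_add_card_eq_card hT
  have h1' : (#{b ∈ B | q b} : ℝ) ≤ #{b ∈ T | q b} + #(B \ T) := mod_cast h1
  have h2' : (#(B \ T) : ℝ) + #T = #B := mod_cast h2
  linarith

open Classical in
/-- In a super-regular pair, two sets of total size `n + 1` span many edges. -/
lemma IsSuperRegular.le_card_interedges {X : Type*} {G : SimpleGraph X} {d : ℝ} (hd : 0 < d)
    {A B : Finset X} {n : ℕ} (hA : #A = n) (hB : #B = n) (h : IsSuperRegular G (d / 2) d A B)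
    {S T : Finset X} (hS : S ⊆ A) (hT : T ⊆ B) (hST : #S + #T = n + 1) :
    d / 2 * n * (min #S #T : ℕ) ≤ (#(G.interedges S T) : ℝ) := by
  obtain ⟨hreg, hdegA, hdegB⟩ := h
  have hSn : #S ≤ n := hA ▸ Finset.card_le_card hS
  have hTn : #T ≤ n := hB ▸ Finset.card_le_card hT
  have hST' : (#S : ℝ) + #T = n + 1 := mod_cast hST
  rw [hB] at hdegA
  rw [hA] at hdegB
  -- `T` misses only `#S - 1` vertices of `B`, so each vertex of a small `S` keeps `(d/2) n`
  -- neighbours in `T`.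
  by_cases hs : (#S : ℝ) ≤ d / 2 * n
  · have hcard : (#(G.interedges S T) : ℝ) = ∑ a ∈ S, (#{b ∈ T | G.Adj a b} : ℝ) := by
      rw [SimpleGraph.interedges_def, ← Nat.cast_sum]
      simp only [Finset.card_filter, Finset.sum_product]
    have hle : ∀ a ∈ S, d / 2 * n ≤ (#{b ∈ T | G.Adj a b} : ℝ) := fun a ha ↦ by
      have := card_filter_sub_le (fun b ↦ G.Adj a b) hT (hdegA a (hS ha))
      rw [hB] at this
      linarith
    rw [hcard]
    calc d / 2 * n * (min #S #T : ℕ) ≤ d / 2 * n * #S := by gcongr; exact min_le_left _ _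
      _ = ∑ a ∈ S, d / 2 * n := by rw [Finset.sum_const, nsmul_eq_mul, mul_comm]
      _ ≤ _ := Finset.sum_le_sum hle
  by_cases ht : (#T : ℝ) ≤ d / 2 * n
  · have hcard : (#(G.interedges S T) : ℝ) = ∑ b ∈ T, (#{a ∈ S | G.Adj a b} : ℝ) := by
      rw [SimpleGraph.interedges_def, ← Nat.cast_sum]
      simp only [Finset.card_filter, Finset.sum_product_right]
    have hle : ∀ b ∈ T, d / 2 * n ≤ (#{a ∈ S | G.Adj a b} : ℝ) := fun b hb ↦ by
      have := card_filter_sub_le (fun a ↦ G.Adj a b) hS (hdegB b (hT hb))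
      rw [hA] at this
      linarith
    rw [hcard]
    calc d / 2 * n * (min #S #T : ℕ) ≤ d / 2 * n * #T := by gcongr; exact min_le_right _ _
      _ = ∑ b ∈ T, d / 2 * n := by rw [Finset.sum_const, nsmul_eq_mul, mul_comm]
      _ ≤ _ := Finset.sum_le_sum hle
  have hS0 : (0 : ℝ) < #S := by exact_mod_cast (show 0 < #S by omega)
  have hT0 : (0 : ℝ) < #T := by exact_mod_cast (show 0 < #T by omega)
  -- Neither set is small, so regularity applies; the larger one has at least `n / 2` vertices.
  have hdens := hreg S hS T hT (by rw [hA]; linarith) (by rw [hB]; linarith)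
  rw [SimpleGraph.edgeDensity_def] at hdens
  push_cast at hdens
  rw [le_div_iff₀ (by positivity)] at hdens
  refine le_trans ?_ hdens
  have hmm : (#S : ℝ) * #T = (max #S #T : ℕ) * (min #S #T : ℕ) := by
    exact_mod_cast (max_mul_min #S #T).symm
  have hmax : (n : ℝ) ≤ 2 * (max #S #T : ℕ) := by
    exact_mod_cast (show n ≤ 2 * max #S #T by omega)
  rw [hmm, ← mul_assoc]
  exact mul_le_mul_of_nonneg_right (by nlinarith) (by positivity)

/-- Disjoint triangles from two matchings of `V`, one into `U` and one into `W`, such that the two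
partners of each vertex of `V` are adjacent. -/
lemma hasTriangleFactorOn_of_matchings {X : Type*} [DecidableEq X] {H : SimpleGraph X}
    {U V W : Finset X} {n : ℕ} (hU : #U = n) (hV : #V = n) (hW : #W = n) (hUV : Disjoint U V)
    (hVW : Disjoint V W) (hUW : Disjoint U W) {f g : X → X} (hf : Set.InjOn f V)
    (hg : Set.InjOn g V) (hfU : ∀ v ∈ V, f v ∈ U ∧ H.Adj v (f v))
    (hgW : ∀ v ∈ V, g v ∈ W ∧ H.Adj v (g v) ∧ H.Adj (f v) (g v)) :
    HasTriangleFactorOn H (U ∪ V ∪ W) := by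
  have hUV' := Finset.disjoint_left.1 hUV
  have hVW' := Finset.disjoint_left.1 hVW
  have hUW' := Finset.disjoint_left.1 hUW
  have hdisj : ∀ v ∈ V, ∀ w ∈ V, v ≠ w →
      Disjoint ({v, f v, g v} : Finset X) {w, f w, g w} := fun v hv w hw hvw ↦ by
    have h1 := hf.ne hv hw hvw
    have h2 := hg.ne hv hw hvw
    have := hfU v hv
    have := hfU w hw
    have := hgW v hv
    have := hgW w hw
    rw [Finset.disjoint_left]
    intro x hx hy
    simp only [Finset.mem_insert, Finset.mem_singleton] at hx hy
    grind
  refine ⟨V.image fun v ↦ {v, f v, g v}, ?_, ?_, ?_⟩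
  · simp only [Finset.mem_image, forall_exists_index, and_imp, forall_apply_eq_imp_iff₂]
    refine fun v hv ↦ ⟨?_, SimpleGraph.is3Clique_triple_iff.2
      ⟨(hfU v hv).2, (hgW v hv).2.1, (hgW v hv).2.2⟩⟩
    have := (hfU v hv).1
    have := (hgW v hv).1
    intro x hx
    simp only [Finset.mem_insert, Finset.mem_singleton] at hx
    simp only [Finset.mem_union]
    grind
  · intro s hs t ht hst
    simp only [Finset.coe_image, Set.mem_image, Finset.mem_coe] at hs ht
    obtain ⟨v, hv, rfl⟩ := hs
    obtain ⟨w, hw, rfl⟩ := ht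
    exact hdisj v hv w hw fun h ↦ hst (by rw [h])
  · rw [Finset.card_image_of_injOn, Finset.card_union_of_disjoint, Finset.card_union_of_disjoint hUV,
      hU, hV, hW]
    · omega
    · exact Finset.disjoint_union_left.2 ⟨hUW, hVW⟩
    · intro v hv w hw hvw
      by_contra hne
      have hd := hdisj v hv w hw hne
      simp only at hvw
      rw [← hvw, disjoint_self] at hd
      exact Finset.insert_ne_empty _ _ hd

/-! ### Avoidance probabilities in the random graph -/

/-- The probability that a random set avoids a given finite set. -/
lemma setBernoulli_real_disjoint {ι : Type*} {u : Set ι} (p : I) {F : Finset ι}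
    (hF : (F : Set ι) ⊆ u) :
    setBer(u, p).real {s | Disjoint (F : Set ι) s} = (1 - p : ℝ) ^ #F := by
  rw [measureReal_def, setBernoulli_apply']
  have : (fun p : ι → Prop ↦ {i | p i}) ⁻¹' {s | Disjoint (F : Set ι) s} =
      Set.pi (F : Set ι) fun _ ↦ ({False} : Set Prop) := by
    ext q
    simp [Set.disjoint_left, Set.mem_pi]
  rw [this, Measure.infinitePi_pi _ (fun _ _ ↦ MeasurableSet.of_discrete),
    Finset.prod_congr rfl (g := fun _ ↦ (toNNReal (σ p) : ENNReal)) (fun i hi ↦ by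
      simp [hF hi])]
  simp

instance {X : Type*} [Finite X] : DiscreteMeasurableSpace (SimpleGraph X) where
  forall_measurableSet s := by
    rw [← s.preimage_image_eq SimpleGraph.edgeSet_injective]
    exact SimpleGraph.measurable_edgeSet .of_discrete

instance {X : Type*} (U W : Finset X) (p : I) : IsProbabilityMeasure (bipartiteRandom U W p) :=
  Measure.isProbabilityMeasure_map SimpleGraph.measurable_fromEdgeSet.aemeasurable

open Classical in
/-- The probability that `G(U, W, p)` contains none of the edges `f(s)t` with `st` an edge of `G`
between `S` and `T`. -/
lemma bipartiteRandom_real_avoid {X : Type*} [Finite X] (G : SimpleGraph X) {U V W : Finset X}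
    (hUW : Disjoint U W) (p : I) {f : X → X} (hf : Set.InjOn f V) (hfU : ∀ v ∈ V, f v ∈ U)
    {S T : Finset X} (hS : S ⊆ V) (hT : T ⊆ W) :
    (bipartiteRandom U W p).real {R | ∀ s ∈ S, ∀ t ∈ T, ¬(G.Adj s t ∧ R.Adj (f s) t)} =
      (1 - p : ℝ) ^ #(G.interedges S T) := by
  have hne : ∀ u ∈ U, ∀ w ∈ W, u ≠ w := fun u hu w hw ↦ by
    rintro rfl
    exact Finset.disjoint_left.1 hUW hu hw
  set F : Finset (Sym2 X) := (G.interedges S T).image fun e ↦ s(f e.1, e.2) with hF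
  have hFc : #F = #(G.interedges S T) := by
    refine Finset.card_image_of_injOn fun a ha b hb hab ↦ ?_
    rw [Finset.mem_coe, SimpleGraph.mem_interedges_iff] at ha hb
    rcases Sym2.eq_iff.1 hab with ⟨h1, h2⟩ | ⟨h1, h2⟩
    · exact Prod.ext (hf (hS ha.1) (hS hb.1) h1) h2
    -- An unordered pair cannot coincide with another after swapping ends, since `U` and `W` are
    -- disjoint.
    · exact (hne _ (hfU _ (hS ha.1)) _ (hT hb.2.1) h1).elim
  have hFu : (F : Set (Sym2 X)) ⊆ (SimpleGraph.between (U : Set X) (W : Set X) ⊤).edgeSet := by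
    intro e he
    obtain ⟨a, ha, rfl⟩ := Finset.mem_image.1 (Finset.mem_coe.1 he)
    rw [SimpleGraph.mem_interedges_iff] at ha
    have h1 := hfU _ (hS ha.1)
    have h2 := hT ha.2.1
    exact ⟨hne _ h1 _ h2, .inl ⟨h1, h2⟩⟩
  rw [bipartiteRandom, map_measureReal_apply SimpleGraph.measurable_fromEdgeSet .of_discrete,
    ← hFc, ← setBernoulli_real_disjoint p hFu]
  congr 1
  ext E
  simp only [Set.mem_preimage, Set.mem_ofPred_eq, SimpleGraph.fromEdgeSet_adj, Set.disjoint_left,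
    Finset.mem_coe, hF, Finset.mem_image, SimpleGraph.mem_interedges_iff, Prod.exists]
  constructor
  · rintro h _ ⟨a, b, ⟨ha, hb, hab⟩, rfl⟩ hE
    exact h a ha b hb ⟨hab, hE, hne _ (hfU _ (hS ha)) _ (hT hb)⟩
  · rintro h s hs t ht ⟨hst, hE, -⟩
    exact h ⟨s, t, ⟨hs, ht, hst⟩, rfl⟩ hE

/-! ### Estimates for the union bound -/

/-- If `p ≥ (8 / d) log n / n` and `e ≥ (d / 2) n m`, then the probability that `e` independent
events of probability `p` all fail is at most `n ^ (-4m)`. -/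
lemma one_sub_pow_le_of_log_div_le {d p : ℝ} (hd : 0 < d) {n e m : ℕ} (hn : 0 < n) (hp1 : p ≤ 1)
    (hp : 8 / d * Real.log n / n ≤ p) (he : d / 2 * n * m ≤ e) :
    (1 - p) ^ e ≤ ((n : ℝ) ^ (4 * m))⁻¹ := by
  have hn' : (0 : ℝ) < n := mod_cast hn
  have hlog : 0 ≤ Real.log n := Real.log_natCast_nonneg n
  have hp0 : 0 ≤ p := le_trans (by positivity) hp
  calc (1 - p) ^ e ≤ Real.exp (-p) ^ e :=
        pow_le_pow_left₀ (by linarith) (by linarith [Real.add_one_le_exp (-p)]) _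
    _ = Real.exp (-(e * p)) := by rw [← Real.exp_nat_mul]; ring_nf
    _ ≤ Real.exp (-((4 * m : ℕ) * Real.log n)) := by
        refine Real.exp_le_exp.2 (neg_le_neg ?_)
        calc ((4 * m : ℕ) : ℝ) * Real.log n
            = d / 2 * n * m * (8 / d * Real.log n / n) := by push_cast; field_simp; ring
          _ ≤ e * p := by gcongr
    _ = ((n : ℝ) ^ (4 * m))⁻¹ := by
        rw [Real.exp_neg, Real.exp_nat_mul, Real.exp_log hn']

/-- The number of pairs of an `s`-set and a `t`-set in an `n`-set, where `s + t = n + 1`. -/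
lemma choose_mul_choose_le {n s t : ℕ} (hs : s ≤ n) (ht : t ≤ n) (hst : s + t = n + 1) :
    n.choose s * n.choose t ≤ n ^ (2 * min s t) := by
  wlog h : s ≤ t generalizing s t
  · rw [mul_comm, min_comm]
    exact this ht hs (by omega) (by omega)
  have hn : 0 < n := by omega
  -- Complementing the larger set turns its count into `n.choose (s - 1)`, so both factors are at
  -- most `n ^ s`.
  rw [min_eq_left h, two_mul, pow_add, ← Nat.choose_symm ht, show n - t = s - 1 by omega]
  exact Nat.mul_le_mul (Nat.choose_le_pow _ _)
    ((Nat.choose_le_pow _ _).trans (Nat.pow_le_pow_right hn (by omega)))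

/-- The sum of `n ^ (-4 min(#S, #T))` over all `S ⊆ V` and `T ⊆ W` with `#S + #T = n + 1` is at most
`1 / n`. -/
lemma sum_inv_pow_min_card_le {X : Type*} {V W : Finset X} {n : ℕ} (hn : 0 < n) (hV : #V = n) (hW : #W = n) :
    ∑ x ∈ (V.powerset ×ˢ W.powerset).filter (fun x ↦ #x.1 + #x.2 = n + 1),
      ((n : ℝ) ^ (4 * min #x.1 #x.2))⁻¹ ≤ (n : ℝ)⁻¹ := by
  have hn1 : (1 : ℝ) ≤ n := mod_cast hn
  have hdisj : ((Finset.Icc 1 n : Finset ℕ) : Set ℕ).PairwiseDisjoint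
      fun s ↦ V.powersetCard s ×ˢ W.powersetCard (n + 1 - s) := fun i _ j _ hij ↦
    Finset.disjoint_left.2 fun x hx hy ↦ hij <| by
      rw [Finset.mem_product, Finset.mem_powersetCard] at hx hy
      rw [← hx.1.2, hy.1.2]
  have hsub : (V.powerset ×ˢ W.powerset).filter (fun x ↦ #x.1 + #x.2 = n + 1) ⊆
      (Finset.Icc 1 n).disjiUnion _ hdisj := by
    rintro ⟨S, T⟩ hx
    simp only [Finset.mem_filter, Finset.mem_product, Finset.mem_powerset] at hx
    have := Finset.card_le_card hx.1.1
    have := Finset.card_le_card hx.1.2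
    simp only [Finset.mem_disjiUnion, Finset.mem_Icc, Finset.mem_product, Finset.mem_powersetCard]
    exact ⟨#S, by omega, ⟨hx.1.1, rfl⟩, hx.1.2, by omega⟩
  refine (Finset.sum_le_sum_of_subset_of_nonneg hsub fun _ _ _ ↦ by positivity).trans ?_
  rw [Finset.sum_disjiUnion]
  -- Each size contributes at most `n ^ (2m) * n ^ (-4m) ≤ n ^ (-2)`, because `m ≥ 1`.
  calc _ ≤ ∑ s ∈ Finset.Icc 1 n, ((n : ℝ) ^ 2)⁻¹ := Finset.sum_le_sum fun s hs ↦ ?_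
    _ = (n : ℝ)⁻¹ := by
      rw [Finset.sum_const, Nat.card_Icc, Nat.add_sub_cancel, nsmul_eq_mul]
      field_simp
  rw [Finset.mem_Icc] at hs
  set m := min s (n + 1 - s) with hm
  have hm1 : 1 ≤ m := by omega
  rw [Finset.sum_congr rfl (g := fun _ ↦ ((n : ℝ) ^ (4 * m))⁻¹) (fun x hx ↦ by
    rw [Finset.mem_product, Finset.mem_powersetCard, Finset.mem_powersetCard] at hx
    rw [hx.1.2, hx.2.2]), Finset.sum_const, Finset.card_product, Finset.card_powersetCard,
    Finset.card_powersetCard, hV, hW, nsmul_eq_mul]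
  have hc : ((n.choose s * n.choose (n + 1 - s) : ℕ) : ℝ) ≤ (n : ℝ) ^ (2 * m) := by
    exact_mod_cast choose_mul_choose_le hs.2 (by omega) (by omega)
  calc _ ≤ (n : ℝ) ^ (2 * m) * ((n : ℝ) ^ (4 * m))⁻¹ := by gcongr
    _ = ((n : ℝ) ^ (2 * m))⁻¹ := by
      rw [show 4 * m = 2 * m + 2 * m by ring, pow_add]
      field_simp
    _ ≤ ((n : ℝ) ^ 2)⁻¹ := by
      gcongr
      omega

theorem mainTheorem6 (d : ℝ) (hd0 : 0 < d) (hd1 : d < 1) :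
    ∃ ε : ℝ, 0 < ε ∧ ∃ C : ℝ, 0 < C ∧
      ∀ η : ℝ, 0 < η → ∃ n₀ : ℕ, ∀ n : ℕ, n₀ ≤ n →
        ∀ (X : Type*) [Fintype X] [DecidableEq X] (G : SimpleGraph X) (U V W : Finset X),
          #U = n → #V = n → #W = n →
          Disjoint U V → Disjoint V W → Disjoint U W →
          IsSuperRegular G ε d V U → IsSuperRegular G ε d V W →
          ∀ p : I, C * Real.log (n : ℝ) / (n : ℝ) ≤ (p : ℝ) →
            1 - η ≤ (bipartiteRandom U W p).real
              {R : SimpleGraph X | HasTriangleFactorOn (G ⊔ R) (U ∪ V ∪ W)} := by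
  classical
  -- `C = 8 / d` makes `(d/2) n m p` at least `4 m log n`; the choice of `n₀` gives `1 / n ≤ η` and
  -- `n > 0`.
  refine ⟨d / 2, by positivity, 8 / d, by positivity, fun η hη ↦ ⟨⌈η⁻¹⌉₊ + 1, ?_⟩⟩
  intro n hn X _ _ G U V W hU hV hW hUV hVW hUW hVUreg hVWreg p hp
  have hn0 : 0 < n := by omega
  have hn0' : (0 : ℝ) < n := mod_cast hn0
  have hnη : (n : ℝ)⁻¹ ≤ η := by
    refine inv_le_of_inv_le₀ hη ((Nat.le_ceil _).trans ?_)
    exact_mod_cast (show ⌈η⁻¹⌉₊ ≤ n by omega)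
  have : Nonempty X := (Finset.card_pos.1 (hV ▸ hn0)).to_type
  obtain ⟨f, hf, hfU⟩ := exists_matching_of_no_bipartite_hole G.Adj hV hU fun S hS T hT hST ↦ by
    have hS' := Finset.card_le_card hS
    have hT' := Finset.card_le_card hT
    have hm : (0 : ℝ) < (min #S #T : ℕ) := by exact_mod_cast (show 0 < min #S #T by omega)
    have he := hVUreg.le_card_interedges hd0 hV hU hS hT hST
    have hpos : (0 : ℝ) < #(G.interedges S T) := lt_of_lt_of_le (by positivity) he
    obtain ⟨⟨a, b⟩, hab⟩ := Finset.card_pos.1 (Nat.cast_pos.1 hpos)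
    rw [SimpleGraph.mem_interedges_iff] at hab
    exact ⟨a, hab.1, b, hab.2.1, hab.2.2⟩
  set μ := bipartiteRandom U W p
  set good : Set (SimpleGraph X) :=
    {R : SimpleGraph X | HasTriangleFactorOn (G ⊔ R) (U ∪ V ∪ W)}
  set bad : Finset X × Finset X → Set (SimpleGraph X) := fun x ↦
    {R | ∀ s ∈ x.1, ∀ t ∈ x.2, ¬(G.Adj s t ∧ R.Adj (f s) t)}
  set P := (V.powerset ×ˢ W.powerset).filter (fun x ↦ #x.1 + #x.2 = n + 1)
  have hcover : goodᶜ ⊆ ⋃ x ∈ P, bad x := by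
    intro R hR
    by_contra hbad
    refine hR ?_
    obtain ⟨g, hg, hgW⟩ := exists_matching_of_no_bipartite_hole
      (fun v w ↦ G.Adj v w ∧ R.Adj (f v) w) hV hW fun S hS T hT hST ↦ by
        by_contra! hno
        refine hbad (Set.mem_iUnion₂.2 ⟨(S, T), ?_, fun s hs t ht hst ↦ hno s hs t ht hst.1 hst.2⟩)
        simp [P, hS, hT, hST]
    exact hasTriangleFactorOn_of_matchings hU hV hW hUV hVW hUW hf hg
      (fun v hv ↦ ⟨(hfU v hv).1, .inl (hfU v hv).2⟩)
      (fun v hv ↦ ⟨(hgW v hv).1, .inl (hgW v hv).2.1, .inr (hgW v hv).2.2⟩)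
  have hle : μ.real goodᶜ ≤ (n : ℝ)⁻¹ := calc
    μ.real goodᶜ ≤ μ.real (⋃ x ∈ P, bad x) := measureReal_mono hcover (measure_ne_top _ _)
    _ ≤ ∑ x ∈ P, μ.real (bad x) := measureReal_biUnion_finset_le _ _
    _ ≤ ∑ x ∈ P, ((n : ℝ) ^ (4 * min #x.1 #x.2))⁻¹ := by
      refine Finset.sum_le_sum fun x hx ↦ ?_
      simp only [P, Finset.mem_filter, Finset.mem_product, Finset.mem_powerset] at hx
      rw [bipartiteRandom_real_avoid G hUW p hf (fun v hv ↦ (hfU v hv).1) hx.1.1 hx.1.2]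
      exact one_sub_pow_le_of_log_div_le hd0 hn0 p.2.2 hp
        (hVWreg.le_card_interedges hd0 hV hW hx.1.1 hx.1.2 hx.2)
    _ ≤ (n : ℝ)⁻¹ := sum_inv_pow_min_card_le hn0 hV hW
  have := probReal_compl_eq_one_sub (μ := μ) (s := good) .of_discrete
  linarith
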